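/- For a complex number $q$ with $|q|<1$ write $(q)_n=\prod_{k=1}^{n}(1-q^k)$. Then, all three series being absolutely convergent, $$\sum_{n=1}^{\infty}\frac{q^n}{1-q^n}+\sum_{n=1}^{\infty}\frac{q^{n(n+1)}}{(1-q^n)(q)_n^2}=\sum_{n=1}^{\infty}\frac{q^n}{(1-q^n)(q)_n}.$$ For a partition $\pi$ of a positive integer, let $l(\pi)$ be its largest part, $\nu(i)$ the number of appearances of $i$ in $\pi$, and $L(\pi)=\nu(l(\pi))$ the number of appearances of the largest part. Let $\mathcal{P}^*(n)$ be the set of partitions of $n$ without gaps, that is, those whose set of distinct parts is exactly $\{1,2,\dots,l(\pi)\}$. Let $d(n)$ be the number of positive divisors of $n$, let $\mathrm{lpt}(n)=\sum_{\pi}L(\pi)$, summed over all partitions $\pi$ of $n$, be the total number of appearances of largest parts in all partitions of $n$, and let $$w(n)=\sum_{\substack{\pi\in\mathcal{P}^*(n)\\ \nu(i)\ge 2,\ 1\le i\le l(\pi)}}\frac{L(\pi)(L(\pi)-1)}{2}\prod_{i=1}^{l(\pi)-1}(\nu(i)-1).$$ Then, for every integer $n\ge 1$, $$d(n)+w(n)=\mathrm{lpt}(n).$$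 -/

import Mathlib

/-- The `q`-Pochhammer symbol `(A; q)_n = (1 - A) (1 - A q) ⋯ (1 - A q ^ (n - 1))`. -/
def qPoch (A q : ℂ) (n : ℕ) : ℂ := ∏ i ∈ Finset.range n, (1 - A * q ^ i)

namespace Nat.Partition

/-- `ν(i)`: the number of appearances of `i` in the partition. -/
def nu {n : ℕ} (p : n.Partition) (i : ℕ) : ℕ := p.parts.count i

/-- `l(π)`: the largest part (`0` for the empty partition). -/
def largestPart {n : ℕ} (p : n.Partition) : ℕ := p.parts.sup

/-- `L(π)`: the number of appearances of the largest part. -/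
def largestMult {n : ℕ} (p : n.Partition) : ℕ := p.nu p.largestPart

/-- Partitions without gaps: the integers that occur as parts are exactly `1, 2, …, l(π)`. -/
def GapFree {n : ℕ} (p : n.Partition) : Prop :=
  p.parts.toFinset = Finset.Icc 1 p.largestPart

instance {n : ℕ} (p : n.Partition) : Decidable p.GapFree :=
  inferInstanceAs (Decidable (p.parts.toFinset = Finset.Icc 1 p.largestPart))

end Nat.Partition

/-- `lpt(n)`: the total number of appearances of largest parts in all partitions of `n`. -/
def lpt (n : ℕ) : ℕ := ∑ p : n.Partition, p.largestMult

/-- `w(n)`: the sum, over the gap-free partitions of `n` in which each of `1, …, l(π)` appears at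
least twice, of `L(π) (L(π) - 1) / 2 * ∏_{i = 1}^{l(π) - 1} (ν(i) - 1)`. -/
def weightedCount (n : ℕ) : ℚ :=
  ∑ p : n.Partition with p.GapFree ∧ ∀ i ∈ Finset.Icc 1 p.largestPart, 2 ≤ p.nu i,
    (p.largestMult : ℚ) * ((p.largestMult : ℚ) - 1) / 2 *
      ∏ i ∈ Finset.Icc 1 (p.largestPart - 1), ((p.nu i : ℚ) - 1)

/-!
The `q`-series identity is the case `z = 1` of
`∑ (zq)^n / (1 - q^n) + ∑ z^n q^(n(n+1)) / ((1 - q^n) (q)_n (zq; q)_n)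
  = ∑ (zq)^n / ((1 - q^n) (q)_n)`, all sums over `n ≥ 1`
(`tsum_divisorTerm_add_tsum_gapFreeTerm`). Passing from `z` to `zq` removes the factors `1 - q^n`
from the denominators: the increments of the three series are `zq / (1 - zq)`, the terms with
`n ≥ 1` of `∑ z^n q^(n(n+1)) / ((q)_n (zq; q)_(n+1))`, and the terms with `n ≥ 1` of
`∑ (zq)^n / (q)_n`. The last two series, summed over `n ≥ 0`, are equal (`tsum_durfeeTerm_eq`); both
are `1 / (zq; q)_∞`, by Durfee rectangles and by Euler, but it suffices that both solve
`f (zq) = (1 - zq) f z` and tend to `1` at `z = 0`. Hence the difference of the two sides of the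
deformed identity is invariant under `z ↦ zq`; being `O(z)`, it vanishes.

For the partition identity, a partition with largest part `N` is given by the multiplicities of
`1, …, N`, so the three series are the generating functions of `d(n)`, `w(n)` and `lpt(n)`: their
`N`-th terms are values of finite products of series `∑ c, w c * X ^ (i * c)` with natural
coefficients (`coeff_prod_multSeries`, `hasSum_coeff_prod_multSeries`). Since the coefficients are
nonnegative, the sum over `N` may be taken coefficientwise (`hasSum_of_evalsTo`), and the
coefficients of a power series converging on the unit disc are unique (`coeff_eq_of_hasSum`).
-/

/-! ### Bounds for the `q`-Pochhammer symbol -/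

theorem qPoch_succ (A q : ℂ) (n : ℕ) : qPoch A q (n + 1) = qPoch A q n * (1 - A * q ^ n) :=
  Finset.prod_range_succ _ _

theorem qPoch_succ' (A q : ℂ) (n : ℕ) : qPoch A q (n + 1) = (1 - A) * qPoch (A * q) q n := by
  unfold qPoch
  rw [Finset.prod_range_succ', mul_comm]
  congr 1
  · simp
  · exact Finset.prod_congr rfl fun i _ => by ring

/-- On the closed unit disc in `z`, the products `(zq; q)_n` are bounded away from zero uniformly
in `z` and `n`, because `∏ (1 - ‖q‖ ^ (i + 1))` converges to a positive number. -/
theorem exists_le_norm_qPoch {q : ℂ} (hq : ‖q‖ < 1) :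
    ∃ c : ℝ, 0 < c ∧ (∀ n : ℕ, c ≤ ‖1 - q ^ (n + 1)‖) ∧
      ∀ z : ℂ, ‖z‖ ≤ 1 → ∀ n, c ≤ ‖qPoch (z * q) q n‖ := by
  set r := ‖q‖ with hr
  have hr0 : 0 ≤ r := norm_nonneg q
  have hpos : ∀ i : ℕ, 0 < 1 + -r ^ (i + 1) := fun i => by
    have := pow_lt_one₀ hr0 hq (Nat.succ_ne_zero i)
    simp only [Nat.succ_eq_add_one] at this
    linarith
  have hs : Summable fun i : ℕ => ‖-r ^ (i + 1)‖ := by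
    have : Summable fun i : ℕ => r ^ (i + 1) :=
      (summable_nat_add_iff 1).2 (summable_geometric_of_lt_one hr0 hq)
    simpa [abs_of_nonneg hr0] using this
  have hne := tprod_one_add_ne_zero_of_summable (fun i => (hpos i).ne') hs
  have hlim := (multipliable_one_add_of_summable hs).hasProd.tendsto_prod_nat
  set c := ∏' i : ℕ, (1 + -r ^ (i + 1)) with hc
  have hanti : Antitone fun n : ℕ => ∏ i ∈ Finset.range n, (1 + -r ^ (i + 1)) :=
    antitone_nat_of_succ_le fun n => by
      rw [Finset.prod_range_succ]
      refine mul_le_of_le_one_right (Finset.prod_nonneg fun i _ => (hpos i).le) ?_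
      have := pow_nonneg hr0 (n + 1)
      linarith
  have hle := hanti.le_of_tendsto hlim
  have hc0 : 0 ≤ c := ge_of_tendsto' hlim fun n => Finset.prod_nonneg fun i _ => (hpos i).le
  refine ⟨c, lt_of_le_of_ne hc0 hne.symm, fun n => ?_, fun z hz n => ?_⟩
  · have h1 : c ≤ 1 - r := by simpa [← sub_eq_add_neg] using hle 1
    have h2 : r ^ (n + 1) ≤ r := pow_le_of_le_one hr0 hq.le (Nat.succ_ne_zero n)
    have h3 := norm_sub_norm_le (1 : ℂ) (q ^ (n + 1))
    rw [norm_one, norm_pow] at h3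
    linarith
  · refine (hle n).trans ?_
    rw [qPoch, norm_prod]
    refine Finset.prod_le_prod (fun i _ => (hpos i).le) fun i _ => ?_
    have h3 := norm_sub_norm_le (1 : ℂ) (z * q * q ^ i)
    have h4 : ‖z * q * q ^ i‖ ≤ r ^ (i + 1) := by
      rw [norm_mul, norm_mul, norm_pow, pow_succ', mul_assoc]
      exact mul_le_of_le_one_left (by positivity) hz
    rw [norm_one] at h3
    linarith

theorem one_sub_pow_succ_ne_zero {q : ℂ} (hq : ‖q‖ < 1) (n : ℕ) : 1 - q ^ (n + 1) ≠ 0 := by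
  obtain ⟨c, hc, h, -⟩ := exists_le_norm_qPoch hq
  exact norm_pos_iff.1 (hc.trans_le (h n))

theorem qPoch_mul_ne_zero {q z : ℂ} (hq : ‖q‖ < 1) (hz : ‖z‖ ≤ 1) (n : ℕ) :
    qPoch (z * q) q n ≠ 0 := by
  obtain ⟨c, hc, -, h⟩ := exists_le_norm_qPoch hq
  exact norm_pos_iff.1 (hc.trans_le (h z hz n))

theorem qPoch_self_ne_zero {q : ℂ} (hq : ‖q‖ < 1) (n : ℕ) : qPoch q q n ≠ 0 := by
  simpa using qPoch_mul_ne_zero (z := 1) hq (by simp) n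

theorem norm_mul_le_one {q z : ℂ} (hq : ‖q‖ < 1) (hz : ‖z‖ ≤ 1) : ‖z * q‖ ≤ 1 := by
  rw [norm_mul]
  exact mul_le_one₀ hz (norm_nonneg _) hq.le

/-- `O(z)` on the closed unit disc, uniformly: the property of a family of series that, at fixed
`q`, yields both their absolute convergence and the vanishing at `z = 0` of their sums. -/
def IsGeomBounded (q : ℂ) (f : ℂ → ℕ → ℂ) : Prop :=
  ∃ K : ℝ, ∀ z : ℂ, ‖z‖ ≤ 1 → ∀ n, ‖f z n‖ ≤ K * ‖z‖ * ‖q‖ ^ n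

namespace IsGeomBounded

variable {q : ℂ} {f g : ℂ → ℕ → ℂ}

theorem summable (hf : IsGeomBounded q f) (hq : ‖q‖ < 1) {z : ℂ} (hz : ‖z‖ ≤ 1) :
    Summable (f z) := by
  obtain ⟨K, hK⟩ := hf
  exact Summable.of_norm_bounded
    ((summable_geometric_of_lt_one (norm_nonneg q) hq).mul_left (K * ‖z‖)) (hK z hz)

theorem exists_norm_tsum_le (hf : IsGeomBounded q f) (hq : ‖q‖ < 1) :
    ∃ K : ℝ, ∀ z : ℂ, ‖z‖ ≤ 1 → ‖∑' n, f z n‖ ≤ K * ‖z‖ := by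
  obtain ⟨K, hK⟩ := hf
  refine ⟨K * (1 - ‖q‖)⁻¹, fun z hz => ?_⟩
  have := tsum_of_norm_bounded
    ((hasSum_geometric_of_lt_one (norm_nonneg q) hq).mul_left (K * ‖z‖)) (hK z hz)
  linarith

/-- All series below have this shape, with a denominator bounded away from zero on the disc. -/
theorem of_norm_den {e : ℕ → ℕ} (he : ∀ n, n ≤ e n) (hq : ‖q‖ < 1) {d : ℂ → ℕ → ℂ} {c : ℝ}
    (hc : 0 < c) (hd : ∀ z : ℂ, ‖z‖ ≤ 1 → ∀ n, c ≤ ‖d z n‖) :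
    IsGeomBounded q fun z n => z ^ (n + 1) * q ^ e n / d z n := by
  refine ⟨c⁻¹, fun z hz n => ?_⟩
  rw [norm_div, norm_mul, norm_pow, norm_pow, div_eq_inv_mul, mul_assoc]
  have h1 : ‖z‖ ^ (n + 1) ≤ ‖z‖ := pow_le_of_le_one (norm_nonneg z) hz (Nat.succ_ne_zero n)
  have h2 : ‖q‖ ^ e n ≤ ‖q‖ ^ n := pow_le_pow_of_le_one (norm_nonneg q) hq.le (he n)
  have h3 := hd z hz n
  gcongr

end IsGeomBounded

/-- A function that is `O(z)` near `0` vanishes at `z` if it does not shrink, up to a constant, along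
the orbit `z * q ^ N`. -/
theorem eq_zero_of_le_norm_orbit {q z : ℂ} (hq : ‖q‖ < 1) (hz : ‖z‖ ≤ 1) {h : ℂ → ℂ} {K c : ℝ}
    (hK : ∀ z : ℂ, ‖z‖ ≤ 1 → ‖h z‖ ≤ K * ‖z‖) (hc : 0 < c)
    (horb : ∀ N : ℕ, c * ‖h z‖ ≤ ‖h (z * q ^ N)‖) : h z = 0 := by
  have hlim : Filter.Tendsto (fun N : ℕ => K * (‖z‖ * ‖q‖ ^ N)) Filter.atTop (nhds 0) := by
    simpa using ((tendsto_pow_atTop_nhds_zero_of_lt_one (norm_nonneg q) hq).const_mul ‖z‖).const_mul K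
  have hle : c * ‖h z‖ ≤ 0 := ge_of_tendsto' hlim fun N => by
    have hN : ‖z * q ^ N‖ ≤ 1 := by
      rw [norm_mul, norm_pow]
      exact mul_le_one₀ hz (by positivity) (pow_le_one₀ (norm_nonneg q) hq.le)
    simpa [norm_mul, norm_pow] using (horb N).trans (hK _ hN)
  have := nonpos_of_mul_nonpos_right hle hc
  simpa using this

/-! ### The Durfee rectangle identity -/

/-- `n`-th term of Euler's series `∑ (zq)^n / (q)_n` for `1 / (zq; q)_∞`. -/
noncomputable def eulerTerm (q z : ℂ) (n : ℕ) : ℂ := z ^ n * q ^ n / qPoch q q n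

/-- `n`-th term of the expansion of `1 / (zq; q)_∞` by the Durfee rectangle of size
`n × (n + 1)`. -/
noncomputable def durfeeTerm (q z : ℂ) (n : ℕ) : ℂ :=
  z ^ n * q ^ (n * (n + 1)) / (qPoch q q n * qPoch (z * q) q (n + 1))

/-- The telescoping certificate for the functional equation of the Durfee rectangle series. -/
noncomputable def durfeeCert (q z : ℂ) (n : ℕ) : ℂ :=
  z ^ n * q ^ (n * (n + 1)) * (1 - q ^ n) / (qPoch q q n * qPoch (z * q * q) q n)

section

variable {q z : ℂ}

theorem isGeomBounded_eulerTerm (hq : ‖q‖ < 1) :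
    IsGeomBounded q fun z n => eulerTerm q z (n + 1) := by
  obtain ⟨c, hc, -, h⟩ := exists_le_norm_qPoch hq
  exact .of_norm_den (e := fun n => n + 1) (fun n => by lia) hq hc
    fun z hz n => by simpa using h 1 (by simp) (n + 1)

theorem isGeomBounded_durfeeTerm (hq : ‖q‖ < 1) :
    IsGeomBounded q fun z n => durfeeTerm q z (n + 1) := by
  obtain ⟨c, hc, -, h⟩ := exists_le_norm_qPoch hq
  refine .of_norm_den (e := fun n => (n + 1) * (n + 1 + 1)) (fun n => by nlinarith) hq
    (mul_pos hc hc) fun z hz n => ?_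
  rw [norm_mul]
  have h1 : c ≤ ‖qPoch q q (n + 1)‖ := by simpa using h 1 (by simp) (n + 1)
  have h2 := h z hz (n + 1 + 1)
  gcongr

theorem summable_eulerTerm (hq : ‖q‖ < 1) (hz : ‖z‖ ≤ 1) : Summable (eulerTerm q z) :=
  (summable_nat_add_iff 1).1 ((isGeomBounded_eulerTerm hq).summable hq hz)

theorem summable_durfeeTerm (hq : ‖q‖ < 1) (hz : ‖z‖ ≤ 1) : Summable (durfeeTerm q z) :=
  (summable_nat_add_iff 1).1 ((isGeomBounded_durfeeTerm hq).summable hq hz)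

theorem tsum_eulerTerm_mul (hq : ‖q‖ < 1) (hz : ‖z‖ ≤ 1) :
    ∑' n, eulerTerm q (z * q) n = (1 - z * q) * ∑' n, eulerTerm q z n := by
  have hs := summable_eulerTerm hq hz
  have hs' := summable_eulerTerm hq (norm_mul_le_one hq hz)
  have hterm : ∀ n, eulerTerm q z (n + 1) - eulerTerm q (z * q) (n + 1)
      = z * q * eulerTerm q z n := fun n => by
    have h1 := qPoch_self_ne_zero hq n
    have h2 := one_sub_pow_succ_ne_zero hq n
    have h3 : qPoch q q (n + 1) = qPoch q q n * (1 - q ^ (n + 1)) := by rw [qPoch_succ, pow_succ']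
    rw [eulerTerm, eulerTerm, eulerTerm, h3]
    field_simp
    ring
  have h0 : eulerTerm q z 0 = eulerTerm q (z * q) 0 := by simp [eulerTerm]
  have hdiff : ∑' n, eulerTerm q z n - ∑' n, eulerTerm q (z * q) n
      = z * q * ∑' n, eulerTerm q z n := by
    rw [hs.tsum_eq_zero_add, hs'.tsum_eq_zero_add, h0, add_sub_add_left_eq_sub,
      ← ((summable_nat_add_iff 1).2 hs).tsum_sub ((summable_nat_add_iff 1).2 hs'),
      tsum_congr hterm, tsum_mul_left, ← h0, ← hs.tsum_eq_zero_add]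
  linear_combination -hdiff

/-- Termwise form of the functional equation `f (zq) = (1 - zq) f z`, up to a telescoping
difference. -/
theorem durfeeTerm_mul_sub (hq : ‖q‖ < 1) (hz : ‖z‖ ≤ 1) (n : ℕ) :
    (1 - z * q) * durfeeTerm q z n - durfeeTerm q (z * q) n
      = durfeeCert q z n - durfeeCert q z (n + 1) := by
  have hzq := norm_mul_le_one hq hz
  have h1 := qPoch_self_ne_zero hq n
  have h2 := one_sub_pow_succ_ne_zero hq n
  have h3 : qPoch q q (n + 1) = qPoch q q n * (1 - q ^ (n + 1)) := by rw [qPoch_succ, pow_succ']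
  have h4 := qPoch_mul_ne_zero hq hzq n
  have h5 := qPoch_mul_ne_zero hq hzq (n + 1)
  have h6 := qPoch_mul_ne_zero hq hz (n + 1)
  rw [qPoch_succ'] at h6
  rw [qPoch_succ] at h5
  have h7 := left_ne_zero_of_mul h6
  have h8 := right_ne_zero_of_mul h5
  rw [durfeeTerm, durfeeTerm, durfeeCert, durfeeCert, h3, qPoch_succ' (z * q),
    qPoch_succ (z * q * q)]
  generalize hD : 1 - z * q * q * q ^ n = D at h8 ⊢
  field_simp
  rw [← hD]
  ring

theorem tsum_durfeeTerm_mul (hq : ‖q‖ < 1) (hz : ‖z‖ ≤ 1) :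
    ∑' n, durfeeTerm q (z * q) n = (1 - z * q) * ∑' n, durfeeTerm q z n := by
  have hs := summable_durfeeTerm hq hz
  have hs' := summable_durfeeTerm hq (norm_mul_le_one hq hz)
  have hcert : Summable (durfeeCert q z) := by
    obtain ⟨c, hc, -, h⟩ := exists_le_norm_qPoch hq
    have hb : IsGeomBounded q fun z n => z ^ (n + 1) * q ^ ((n + 1) * (n + 1 + 1)) /
        (qPoch q q n * qPoch (z * q * q) q (n + 1)) := by
      refine .of_norm_den (e := fun n => (n + 1) * (n + 1 + 1)) (fun n => by nlinarith) hq
        (mul_pos hc hc) fun z hz n => ?_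
      rw [norm_mul]
      have h1 : c ≤ ‖qPoch q q n‖ := by simpa using h 1 (by simp) n
      have h2 := h (z * q) (norm_mul_le_one hq hz) (n + 1)
      gcongr
    refine (summable_nat_add_iff 1).1 ((hb.summable hq hz).congr fun n => ?_)
    have h1 := qPoch_self_ne_zero hq n
    have h2 := one_sub_pow_succ_ne_zero hq n
    have h3 : qPoch q q (n + 1) = qPoch q q n * (1 - q ^ (n + 1)) := by rw [qPoch_succ, pow_succ']
    have h4 := qPoch_mul_ne_zero hq (norm_mul_le_one hq hz) (n + 1)
    rw [durfeeCert, h3]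
    field_simp
  have h0 : durfeeCert q z 0 = 0 := by simp [durfeeCert]
  have key : (1 - z * q) * ∑' n, durfeeTerm q z n - ∑' n, durfeeTerm q (z * q) n = 0 := by
    rw [← tsum_mul_left, ← (hs.mul_left _).tsum_sub hs',
      tsum_congr (durfeeTerm_mul_sub hq hz), hcert.tsum_sub ((summable_nat_add_iff 1).2 hcert),
      hcert.tsum_eq_zero_add, h0]
    ring
  exact (sub_eq_zero.1 key).symm

/-- Euler's series and the Durfee rectangle series are both `1 / (zq; q)_∞`: they satisfy the same
functional equation under `z ↦ zq`, and agree at `z = 0`. -/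
theorem tsum_durfeeTerm_eq (hq : ‖q‖ < 1) (hz : ‖z‖ ≤ 1) :
    ∑' n, durfeeTerm q z n = ∑' n, eulerTerm q z n := by
  obtain ⟨K₁, hK₁⟩ := (isGeomBounded_durfeeTerm hq).exists_norm_tsum_le hq
  obtain ⟨K₂, hK₂⟩ := (isGeomBounded_eulerTerm hq).exists_norm_tsum_le hq
  obtain ⟨c, hc, -, hpoch⟩ := exists_le_norm_qPoch hq
  set h : ℂ → ℂ := fun z => ∑' n, durfeeTerm q z n - ∑' n, eulerTerm q z n with hh
  have hfun : ∀ z : ℂ, ‖z‖ ≤ 1 → h (z * q) = (1 - z * q) * h z := fun z hz => by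
    simp only [hh, tsum_durfeeTerm_mul hq hz, tsum_eulerTerm_mul hq hz, mul_sub]
  have horb : ∀ N : ℕ, ∀ z : ℂ, ‖z‖ ≤ 1 → h (z * q ^ N) = qPoch (z * q) q N * h z := fun N => by
    induction N with
    | zero => intro z _; simp [qPoch]
    | succ N ih =>
      intro z hz
      rw [pow_succ', ← mul_assoc, ih _ (norm_mul_le_one hq hz), hfun z hz, qPoch_succ']
      ring
  have hbound : ∀ z : ℂ, ‖z‖ ≤ 1 → ‖h z‖ ≤ (K₁ + K₂ + c⁻¹) * ‖z‖ := fun z hz => by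
    have h1 : h z = (∑' n, durfeeTerm q z (n + 1) - ∑' n, eulerTerm q z (n + 1))
        + z * q / qPoch (z * q) q 1 := by
      have hne := qPoch_mul_ne_zero hq hz 1
      simp only [hh]
      rw [(summable_durfeeTerm hq hz).tsum_eq_zero_add, (summable_eulerTerm hq hz).tsum_eq_zero_add]
      simp only [qPoch, Finset.prod_range_one, pow_zero, mul_one] at hne
      simp only [durfeeTerm, eulerTerm, qPoch, Finset.prod_range_one, Finset.prod_range_zero,
        zero_add, pow_zero, mul_one, one_mul, div_one]
      field_simp
      ring
    have h2 : ‖z * q / qPoch (z * q) q 1‖ ≤ c⁻¹ * ‖z‖ := by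
      rw [norm_div, norm_mul, div_eq_inv_mul]
      have := hpoch z hz 1
      gcongr
      exact mul_le_of_le_one_right (norm_nonneg z) hq.le
    rw [h1]
    refine (norm_add_le_of_le (norm_sub_le_of_le (hK₁ z hz) (hK₂ z hz)) h2).trans_eq ?_
    ring
  refine sub_eq_zero.1 (eq_zero_of_le_norm_orbit hq hz hbound hc fun N => ?_ : h z = 0)
  rw [horb N z hz, norm_mul]
  gcongr
  exact hpoch z hz N

/-! ### The `q`-series identity -/

/-- `z`-deformation of the generating function of the number of appearances of largest parts. -/
noncomputable def lptTerm (q z : ℂ) (n : ℕ) : ℂ := z ^ n * q ^ n / ((1 - q ^ n) * qPoch q q n)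

/-- `z`-deformation of the Lambert series of the divisor function. -/
noncomputable def divisorTerm (q z : ℂ) (n : ℕ) : ℂ := z ^ n * q ^ n / (1 - q ^ n)

/-- `z`-deformation of the generating function of the weighted gap-free partitions; the deformation
splits `(q)_n ^ 2` into `(q)_n (zq; q)_n`. -/
noncomputable def gapFreeTerm (q z : ℂ) (n : ℕ) : ℂ :=
  z ^ n * q ^ (n * (n + 1)) / ((1 - q ^ n) * qPoch q q n * qPoch (z * q) q n)

theorem isGeomBounded_lptTerm (hq : ‖q‖ < 1) :
    IsGeomBounded q fun z n => lptTerm q z (n + 1) := by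
  obtain ⟨c, hc, h', h⟩ := exists_le_norm_qPoch hq
  refine .of_norm_den (e := fun n => n + 1) (fun n => by lia) hq (mul_pos hc hc) fun z hz n => ?_
  rw [norm_mul]
  have h1 : c ≤ ‖qPoch q q (n + 1)‖ := by simpa using h 1 (by simp) (n + 1)
  have h2 := h' n
  gcongr

theorem isGeomBounded_divisorTerm (hq : ‖q‖ < 1) :
    IsGeomBounded q fun z n => divisorTerm q z (n + 1) := by
  obtain ⟨c, hc, h', -⟩ := exists_le_norm_qPoch hq
  exact .of_norm_den (e := fun n => n + 1) (fun n => by lia) hq hc fun z hz n => h' n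

theorem isGeomBounded_gapFreeTerm (hq : ‖q‖ < 1) :
    IsGeomBounded q fun z n => gapFreeTerm q z (n + 1) := by
  obtain ⟨c, hc, h', h⟩ := exists_le_norm_qPoch hq
  refine .of_norm_den (e := fun n => (n + 1) * (n + 1 + 1)) (fun n => by nlinarith) hq
    (mul_pos (mul_pos hc hc) hc) fun z hz n => ?_
  rw [norm_mul, norm_mul]
  have h1 : c ≤ ‖qPoch q q (n + 1)‖ := by simpa using h 1 (by simp) (n + 1)
  have h2 := h' n
  have h3 := h z hz (n + 1)
  gcongr

theorem lptTerm_sub (hq : ‖q‖ < 1) (n : ℕ) :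
    lptTerm q z (n + 1) - lptTerm q (z * q) (n + 1) = eulerTerm q z (n + 1) := by
  have h1 := qPoch_self_ne_zero hq (n + 1)
  have h2 := one_sub_pow_succ_ne_zero hq n
  rw [lptTerm, lptTerm, eulerTerm]
  field_simp
  ring

theorem divisorTerm_sub (hq : ‖q‖ < 1) (n : ℕ) :
    divisorTerm q z (n + 1) - divisorTerm q (z * q) (n + 1) = (z * q) ^ (n + 1) := by
  have h2 := one_sub_pow_succ_ne_zero hq n
  rw [divisorTerm, divisorTerm]
  field_simp
  ring

/-- The increment of the deformed gap-free series under `z ↦ zq` is a Durfee rectangle term. -/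
theorem gapFreeTerm_sub (hq : ‖q‖ < 1) (hz : ‖z‖ ≤ 1) (n : ℕ) :
    gapFreeTerm q z (n + 1) - gapFreeTerm q (z * q) (n + 1) = durfeeTerm q z (n + 1) := by
  have h1 := qPoch_self_ne_zero hq (n + 1)
  have h2 := one_sub_pow_succ_ne_zero hq n
  have h3 := qPoch_mul_ne_zero hq hz (n + 1)
  have h4 := qPoch_mul_ne_zero hq (norm_mul_le_one hq hz) (n + 1)
  have h5 := qPoch_mul_ne_zero hq hz (n + 2)
  -- the two ways of splitting a factor off `(zq; q)_{n + 2}`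
  have h6 := qPoch_succ (z * q) q (n + 1)
  have h7 := qPoch_succ' (z * q) q (n + 1)
  have h8 : (qPoch (z * q) q (n + 1))⁻¹
      = (1 - z * q * q ^ (n + 1)) / qPoch (z * q) q (n + 2) := by
    rw [h6] at h5 ⊢
    have := right_ne_zero_of_mul h5
    field_simp
  have h9 : (qPoch (z * q * q) q (n + 1))⁻¹ = (1 - z * q) / qPoch (z * q) q (n + 2) := by
    rw [h7] at h5 ⊢
    have := left_ne_zero_of_mul h5
    field_simp
  rw [gapFreeTerm, gapFreeTerm, durfeeTerm, div_eq_mul_inv, div_eq_mul_inv,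
    mul_inv _ (qPoch (z * q) q (n + 1)), mul_inv _ (qPoch (z * q * q) q (n + 1)), h8, h9]
  field_simp
  ring

/-- The `q`-series identity with the additional variable `z`. The difference of the two sides is
invariant under `z ↦ zq`, since the increments are governed by the Durfee rectangle identity, and it
vanishes at `z = 0`. -/
theorem tsum_divisorTerm_add_tsum_gapFreeTerm (hq : ‖q‖ < 1) (hz : ‖z‖ ≤ 1) :
    ∑' n, divisorTerm q z (n + 1) + ∑' n, gapFreeTerm q z (n + 1) = ∑' n, lptTerm q z (n + 1) := by
  have hA := isGeomBounded_lptTerm hq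
  have hB := isGeomBounded_divisorTerm hq
  have hC := isGeomBounded_gapFreeTerm hq
  obtain ⟨K₁, hK₁⟩ := hA.exists_norm_tsum_le hq
  obtain ⟨K₂, hK₂⟩ := hB.exists_norm_tsum_le hq
  obtain ⟨K₃, hK₃⟩ := hC.exists_norm_tsum_le hq
  set h : ℂ → ℂ := fun z => ∑' n, divisorTerm q z (n + 1) + ∑' n, gapFreeTerm q z (n + 1)
    - ∑' n, lptTerm q z (n + 1) with hh
  have hinv : ∀ z : ℂ, ‖z‖ ≤ 1 → h (z * q) = h z := fun z hz => by
    have hzq := norm_mul_le_one hq hz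
    have hlt : ‖z * q‖ < 1 := by
      rw [norm_mul]
      exact (mul_le_of_le_one_left (norm_nonneg q) hz).trans_lt hq
    have hA' : ∑' n, lptTerm q z (n + 1) - ∑' n, lptTerm q (z * q) (n + 1)
        = ∑' n, eulerTerm q z (n + 1) := by
      rw [← (hA.summable hq hz).tsum_sub (hA.summable hq hzq)]
      exact tsum_congr (lptTerm_sub hq)
    have hB' : ∑' n, divisorTerm q z (n + 1) - ∑' n, divisorTerm q (z * q) (n + 1)
        = z * q / (1 - z * q) := by
      rw [← (hB.summable hq hz).tsum_sub (hB.summable hq hzq), tsum_congr (divisorTerm_sub hq)]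
      simp_rw [pow_succ']
      rw [tsum_mul_left, tsum_geometric_of_norm_lt_one hlt, div_eq_mul_inv]
    have hC' : ∑' n, gapFreeTerm q z (n + 1) - ∑' n, gapFreeTerm q (z * q) (n + 1)
        = ∑' n, durfeeTerm q z (n + 1) := by
      rw [← (hC.summable hq hz).tsum_sub (hC.summable hq hzq)]
      exact tsum_congr (gapFreeTerm_sub hq hz)
    have hD := tsum_durfeeTerm_eq hq hz
    rw [(summable_durfeeTerm hq hz).tsum_eq_zero_add, (summable_eulerTerm hq hz).tsum_eq_zero_add]
      at hD
    have h0 : durfeeTerm q z 0 = 1 + z * q / (1 - z * q) := by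
      have hne : 1 - z * q ≠ 0 := fun h0 => by
        rw [← sub_eq_zero.1 h0, norm_one] at hlt
        exact lt_irrefl _ hlt
      simp only [durfeeTerm, qPoch, Finset.prod_range_one, Finset.prod_range_zero, zero_add,
        pow_zero, mul_one, one_mul]
      field_simp
      ring
    have h1 : eulerTerm q z 0 = 1 := by simp [eulerTerm, qPoch]
    rw [h0, h1] at hD
    simp only [hh]
    linear_combination hA' - hB' - hC' - hD
  have horb : ∀ N : ℕ, ∀ z : ℂ, ‖z‖ ≤ 1 → h (z * q ^ N) = h z := fun N => by
    induction N with
    | zero => intro z _; simp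
    | succ N ih =>
      intro z hz
      rw [pow_succ', ← mul_assoc, ih _ (norm_mul_le_one hq hz), hinv z hz]
  have hbound : ∀ z : ℂ, ‖z‖ ≤ 1 → ‖h z‖ ≤ (K₂ + K₃ + K₁) * ‖z‖ := fun z hz =>
    (norm_sub_le_of_le (norm_add_le_of_le (hK₂ z hz) (hK₃ z hz)) (hK₁ z hz)).trans_eq (by ring)
  refine sub_eq_zero.1 (eq_zero_of_le_norm_orbit hq hz hbound one_pos fun N => ?_ : h z = 0)
  rw [horb N z hz, one_mul]

end

/-! ### Generating functions with natural coefficients -/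

/-- Evaluation at the complex number `q` of a power series with natural coefficients: the series
converges at `q` with sum `v`. -/
def EvalsTo (F : PowerSeries ℕ) (q v : ℂ) : Prop :=
  HasSum (fun n => ((PowerSeries.coeff n F : ℕ) : ℂ) * q ^ n) v

namespace EvalsTo

open PowerSeries

variable {F G : PowerSeries ℕ} {q v w : ℂ}

theorem one : EvalsTo 1 q 1 := by
  unfold EvalsTo
  convert hasSum_ite_eq (0 : ℕ) (1 : ℂ) using 2 with n
  by_cases h : n = 0 <;> simp [coeff_one, h]

theorem mul (hF : EvalsTo F q v) (hG : EvalsTo G q w) : EvalsTo (F * G) q (v * w) := by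
  unfold EvalsTo at *
  have hF' := hF.summable.norm
  have hG' := hG.summable.norm
  have hterm : ∀ n, ∑ kl ∈ Finset.HasAntidiagonal.antidiagonal n,
      (((coeff kl.1 F : ℕ) : ℂ) * q ^ kl.1) * (((coeff kl.2 G : ℕ) : ℂ) * q ^ kl.2)
      = ((coeff n (F * G) : ℕ) : ℂ) * q ^ n := fun n => by
    rw [coeff_mul, Nat.cast_sum, Finset.sum_mul]
    refine Finset.sum_congr rfl fun kl hkl => ?_
    rw [← Finset.HasAntidiagonal.mem_antidiagonal.1 hkl, pow_add]
    push_cast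
    ring
  have hs := (summable_norm_sum_mul_antidiagonal_of_summable_norm hF' hG').of_norm
  have ht := tsum_mul_tsum_eq_tsum_sum_antidiagonal_of_summable_norm hF' hG'
  simp_rw [hterm] at hs ht
  rw [← hF.tsum_eq, ← hG.tsum_eq, ht]
  exact hs.hasSum

theorem prod {s : Finset ℕ} {F : ℕ → PowerSeries ℕ} {v : ℕ → ℂ}
    (h : ∀ i ∈ s, EvalsTo (F i) q (v i)) : EvalsTo (∏ i ∈ s, F i) q (∏ i ∈ s, v i) := by
  induction s using Finset.cons_induction with
  | empty => simpa using one
  | cons a s ha ih =>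
    rw [Finset.prod_cons, Finset.prod_cons]
    exact (h a (by simp)).mul (ih fun i hi => h i (by simp [hi]))

end EvalsTo

/-- For `i ≥ 1`, the power series `∑ c, w c * X ^ (i * c)`: the generating function of the
multiplicity `c` of the part `i`, where multiplicity `c` has weight `w c`. -/
noncomputable def multSeries (i : ℕ) (w : ℕ → ℕ) : PowerSeries ℕ :=
  PowerSeries.mk fun n => if i ∣ n then w (n / i) else 0

theorem evalsTo_multSeries {i : ℕ} (hi : 1 ≤ i) {w : ℕ → ℕ} {q v : ℂ}
    (h : HasSum (fun c => (w c : ℂ) * (q ^ i) ^ c) v) : EvalsTo (multSeries i w) q v := by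
  have hinj : Function.Injective fun c : ℕ => i * c := fun a b hab =>
    Nat.eq_of_mul_eq_mul_left hi hab
  refine (hinj.hasSum_iff fun n hn => ?_).1 ?_
  · have : ¬ i ∣ n := fun ⟨c, hc⟩ => hn ⟨c, hc.symm⟩
    simp [multSeries, this]
  · convert h using 2 with c
    simp [multSeries, Nat.mul_div_cancel_left c hi, pow_mul]

/-- The product over the parts `1, …, N` of the generating functions of their multiplicities counts
the partitions with parts in `{1, …, N}`, weighted by the product of the weights of all the
multiplicities, including those that are zero. -/
theorem coeff_prod_multSeries (N n : ℕ) (w : ℕ → ℕ → ℕ) :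
    PowerSeries.coeff n (∏ i ∈ Finset.Icc 1 N, multSeries i (w i)) =
      ∑ p : n.Partition with p.parts.toFinset ⊆ Finset.Icc 1 N,
        ∏ i ∈ Finset.Icc 1 N, w i (p.nu i) := by
  rw [PowerSeries.coeff_prod]
  symm
  refine Finset.sum_of_injOn Nat.Partition.toFinsuppAntidiag
    (Nat.Partition.toFinsuppAntidiag_injective n).injOn (fun p hp => ?_) (fun g hg hg' => ?_)
    fun p hp => ?_
  · have h := (Finset.mem_finsuppAntidiag.1 p.toFinsuppAntidiag_mem_finsuppAntidiag)
    have hp' := (Finset.mem_filter.1 (Finset.mem_coe.1 hp)).2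
    refine Finset.mem_finsuppAntidiag.2 ⟨?_, hp'⟩
    refine Eq.trans ?_ h.1
    refine (Finset.sum_subset (s₁ := p.toFinsuppAntidiag.support) hp' fun x _ hx =>
      Finsupp.notMem_support_iff.1 hx).symm.trans (Finset.sum_subset h.2 fun x _ hx =>
      Finsupp.notMem_support_iff.1 hx)
  · obtain ⟨hsum, hsupp⟩ := Finset.mem_finsuppAntidiag.1 hg
    by_contra hne
    -- a nonzero term has `i ∣ g i` for all `i`, so the multiplicities `g i / i` give a partition
    have hdvd : ∀ i, i ∣ g i := fun i => by
      by_cases hi : i ∈ Finset.Icc 1 N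
      · have := (Finset.prod_ne_zero_iff.1 hne) i hi
        rw [multSeries, PowerSeries.coeff_mk] at this
        by_contra hnd
        exact this (if_neg hnd)
      · rw [Finsupp.notMem_support_iff.1 fun h => hi (hsupp h)]
        exact dvd_zero i
    have hpos : ∀ i ∈ g.support, 0 < i := fun i hi => (Finset.mem_Icc.1 (hsupp hi)).1
    refine hg' ?_
    let f : ℕ →₀ ℕ := ⟨g.support, fun i => g i / i, fun i => by
      rw [Finsupp.mem_support_iff]
      refine ⟨fun h h0 => h ?_, fun h h0 => h (by simp [h0])⟩
      rw [← Nat.div_mul_cancel (hdvd i), h0, zero_mul]⟩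
    refine ⟨⟨f.toMultiset, fun {i} hi => hpos i (by simpa [f] using hi), ?_⟩, ?_, ?_⟩
    · refine Eq.trans ?_ hsum
      suffices ∑ x ∈ g.support, g x / x * x = ∑ x ∈ Finset.Icc 1 N, g x by
        simpa [Finsupp.sum, f] using this
      rw [Finset.sum_congr rfl fun i _ => Nat.div_mul_cancel (hdvd i)]
      exact Finset.sum_subset hsupp fun x _ hx => Finsupp.notMem_support_iff.1 hx
    · simpa [f] using hsupp
    · ext i
      simpa [Nat.Partition.toFinsuppAntidiag, f] using Nat.div_mul_cancel (hdvd i)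
  · refine Finset.prod_congr rfl fun i hi => ?_
    have hi0 : 0 < i := (Finset.mem_Icc.1 hi).1
    simp [multSeries, Nat.Partition.toFinsuppAntidiag, Nat.Partition.nu, hi0]

/-- Uniqueness of the coefficients of a power series converging on the unit disc. -/
theorem coeff_eq_of_hasSum {a b : ℕ → ℂ} {s : ℂ → ℂ}
    (ha : ∀ q : ℂ, ‖q‖ < 1 → HasSum (fun n => a n * q ^ n) (s q))
    (hb : ∀ q : ℂ, ‖q‖ < 1 → HasSum (fun n => b n * q ^ n) (s q)) : a = b := by
  have hd : ∀ q : ℂ, ‖q‖ < 1 → HasSum (fun n => (a - b) n * q ^ n) 0 := fun q hq => by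
    simpa [sub_mul] using (ha q hq).sub (hb q hq)
  have hball : HasFPowerSeriesOnBall (0 : ℂ → ℂ)
      (FormalMultilinearSeries.ofScalars ℂ (a - b)) 0 ((2⁻¹ : NNReal) : ENNReal) := by
    refine ⟨?_, by simp, fun {y} hy => ?_⟩
    · refine FormalMultilinearSeries.le_radius_of_summable _ ?_
      have := (hd (2⁻¹) (by norm_num)).summable.norm
      simpa [FormalMultilinearSeries.ofScalars_norm] using this
    · have hy' : ‖y‖ < 1 := by
        have : ‖y‖ < 2⁻¹ := by
          rw [Metric.mem_eball, edist_zero_right, ← ofReal_norm] at hy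
          have h := (ENNReal.ofReal_lt_iff_lt_toReal (norm_nonneg y) (by simp)).1 hy
          simpa using h
        linarith
      simpa [FormalMultilinearSeries.ofScalars_apply_eq, mul_comm] using hd y hy'
  have h0 := HasFPowerSeriesAt.eq_zero ⟨_, hball⟩
  rw [FormalMultilinearSeries.ofScalars_series_eq_zero] at h0
  exact sub_eq_zero.1 h0

/-- Summation of a series of power series with natural coefficients, coefficient by coefficient.
Absolute convergence of the double series at `q` comes from convergence at the real number `‖q‖`. -/
theorem hasSum_of_evalsTo {F : ℕ → PowerSeries ℕ} {T : ℂ → ℕ → ℂ} {a : ℕ → ℕ}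
    (hF : ∀ q : ℂ, ‖q‖ < 1 → ∀ N, EvalsTo (F N) q (T q N))
    (hT : ∀ q : ℂ, ‖q‖ < 1 → Summable (T q))
    (ha : ∀ n, HasSum (fun N => PowerSeries.coeff n (F N)) (a n)) {q : ℂ} (hq : ‖q‖ < 1) :
    HasSum (fun n => (a n : ℂ) * q ^ n) (∑' N, T q N) := by
  have hq' : ‖((‖q‖ : ℝ) : ℂ)‖ < 1 := by simpa using hq
  set f : ℕ × ℕ → ℂ := fun x => ((PowerSeries.coeff x.2 (F x.1) : ℕ) : ℂ) * q ^ x.2 with hf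
  have hs : Summable f := by
    refine Summable.of_norm ((summable_prod_of_nonneg fun _ => norm_nonneg _).2 ⟨fun N => ?_, ?_⟩)
    · exact (hF q hq N).summable.norm
    · refine (hT _ hq').norm.congr fun N => ?_
      rw [← (hF _ hq' N).tsum_eq]
      have : ∀ n, ((PowerSeries.coeff n (F N) : ℕ) : ℂ) * ((‖q‖ : ℝ) : ℂ) ^ n
          = ((‖f (N, n)‖ : ℝ) : ℂ) := fun n => by simp [hf]
      simp_rw [this]
      rw [← Complex.ofReal_tsum, Complex.norm_real, Real.norm_of_nonneg]
      exact tsum_nonneg fun n => norm_nonneg _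
  have htot : HasSum f (∑' N, T q N) := by
    have h := hs.hasSum
    have h1 := h.prod_fiberwise fun N => hF q hq N
    rwa [← h1.tsum_eq] at h
  refine ((Equiv.prodComm ℕ ℕ).hasSum_iff.2 htot).prod_fiberwise fun n => ?_
  have := (((ha n).map (Nat.castRingHom ℂ) (by fun_prop)).mul_right (q ^ n))
  simpa [hf, Function.comp_def] using this

/-! ### Partitions classified by their largest part -/

/-- The weight of a nonempty partition `p` when, in a partition with largest part `l`, the part `i`
appearing `c` times contributes the factor `w l i c`. The empty partition has weight `0`. -/
def partitionWeight (w : ℕ → ℕ → ℕ → ℕ) {n : ℕ} (p : n.Partition) : ℕ :=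
  if p.largestPart = 0 then 0
  else ∏ i ∈ Finset.Icc 1 p.largestPart, w p.largestPart i (p.nu i)

theorem le_largestPart {n : ℕ} {p : n.Partition} {i : ℕ} (hi : i ∈ p.parts) : i ≤ p.largestPart :=
  Multiset.le_sup hi

theorem toFinset_parts_subset_iff {n N : ℕ} {p : n.Partition} :
    p.parts.toFinset ⊆ Finset.Icc 1 N ↔ p.largestPart ≤ N := by
  refine ⟨fun h => Multiset.sup_le.2 fun i hi => ?_, fun h i hi => ?_⟩
  · exact (Finset.mem_Icc.1 (h (Multiset.mem_toFinset.2 hi))).2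
  · have hi' := Multiset.mem_toFinset.1 hi
    exact Finset.mem_Icc.2 ⟨p.parts_pos hi', (le_largestPart hi').trans h⟩

theorem nu_eq_zero_of_largestPart_lt {n N : ℕ} {p : n.Partition} (h : p.largestPart < N) :
    p.nu N = 0 :=
  Multiset.count_eq_zero.2 fun hN => h.not_ge (le_largestPart hN)

theorem nu_zero {n : ℕ} (p : n.Partition) : p.nu 0 = 0 :=
  Multiset.count_eq_zero.2 fun h => lt_irrefl 0 (p.parts_pos h)

/-- If the weight forces the largest part `l` to appear, the `(N + 1)`-st product of multiplicity
series counts exactly the partitions with largest part `N + 1`. -/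
theorem hasSum_coeff_prod_multSeries {w : ℕ → ℕ → ℕ → ℕ} (hw : ∀ l, w l l 0 = 0) (n : ℕ) :
    HasSum (fun N => PowerSeries.coeff n
      (∏ i ∈ Finset.Icc 1 (N + 1), multSeries i (w (N + 1) i)))
      (∑ p : n.Partition, partitionWeight w p) := by
  simp_rw [coeff_prod_multSeries, Finset.sum_filter]
  refine hasSum_sum fun p _ => ?_
  rcases Nat.eq_zero_or_pos p.largestPart with h0 | hpos
  · rw [partitionWeight, if_pos h0]
    convert hasSum_zero using 2 with N
    refine ite_eq_right_iff.2 fun _ => Finset.prod_eq_zero (i := N + 1) (by simp) ?_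
    rw [nu_eq_zero_of_largestPart_lt (by lia), hw]
  · rw [partitionWeight, if_neg hpos.ne']
    convert hasSum_ite_eq (p.largestPart - 1)
      (∏ i ∈ Finset.Icc 1 p.largestPart, w p.largestPart i (p.nu i)) using 2 with N
    simp only [toFinset_parts_subset_iff]
    by_cases hN : N = p.largestPart - 1
    · have hN' : N + 1 = p.largestPart := by lia
      rw [if_pos hN, hN', if_pos le_rfl]
    · rw [if_neg hN]
      refine ite_eq_right_iff.2 fun hle => Finset.prod_eq_zero (i := N + 1) (by simp) ?_
      rw [nu_eq_zero_of_largestPart_lt (by lia), hw]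

/-- The multiplicity weight of `lpt`. -/
def lptWeight (l i c : ℕ) : ℕ := if i = l then c else 1

/-- The multiplicity weight of `weightedCount`. Truncated subtraction makes it vanish at `c ≤ 1`,
which encodes the condition that every part up to the largest appears at least twice. -/
def gapFreeWeight (l i c : ℕ) : ℕ := if i = l then c.choose 2 else c - 1

theorem prod_Icc_ite_eq {M : Type*} [CommMonoid M] (f g : ℕ → M) {l : ℕ} (hl : l ≠ 0) :
    ∏ i ∈ Finset.Icc 1 l, (if i = l then f i else g i) = (∏ i ∈ Finset.Icc 1 (l - 1), g i) * f l := by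
  obtain ⟨l, rfl⟩ := Nat.exists_eq_succ_of_ne_zero hl
  rw [Nat.succ_eq_add_one, Finset.prod_Icc_succ_top (by lia), if_pos rfl, Nat.add_sub_cancel]
  congr 1
  exact Finset.prod_congr rfl fun i hi => if_neg (by have := (Finset.mem_Icc.1 hi).2; lia)

theorem partitionWeight_lptWeight {n : ℕ} (p : n.Partition) :
    partitionWeight lptWeight p = p.largestMult := by
  rw [partitionWeight]
  split_ifs with h
  · rw [Nat.Partition.largestMult, h, nu_zero]
  · simp only [lptWeight, prod_Icc_ite_eq (fun i => p.nu i) _ h, Finset.prod_const_one, one_mul]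
    rfl

theorem sum_partitionWeight_lptWeight (n : ℕ) :
    ∑ p : n.Partition, partitionWeight lptWeight p = lpt n :=
  Finset.sum_congr rfl fun p _ => partitionWeight_lptWeight p

theorem gapFree_of_two_le_nu {n : ℕ} {p : n.Partition}
    (h : ∀ i ∈ Finset.Icc 1 p.largestPart, 2 ≤ p.nu i) : p.GapFree := by
  refine (toFinset_parts_subset_iff.2 le_rfl).antisymm fun i hi => ?_
  rw [Multiset.mem_toFinset, ← Multiset.count_pos]
  exact two_pos.trans_le (h i hi)

theorem two_le_nu_of_partitionWeight_ne_zero {n : ℕ} {p : n.Partition}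
    (h : partitionWeight gapFreeWeight p ≠ 0) : ∀ i ∈ Finset.Icc 1 p.largestPart, 2 ≤ p.nu i := by
  intro i hi
  rw [partitionWeight] at h
  split_ifs at h with h0
  · exact absurd rfl h
  · have hi' := Finset.prod_ne_zero_iff.1 h i hi
    rw [gapFreeWeight] at hi'
    split_ifs at hi'
    · by_contra hlt
      exact hi' (Nat.choose_eq_zero_of_lt (not_le.1 hlt))
    · lia

theorem sum_partitionWeight_gapFreeWeight (n : ℕ) :
    ((∑ p : n.Partition, partitionWeight gapFreeWeight p : ℕ) : ℚ) = weightedCount n := by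
  have hfilter : ∑ p : n.Partition with
      p.GapFree ∧ ∀ i ∈ Finset.Icc 1 p.largestPart, 2 ≤ p.nu i, partitionWeight gapFreeWeight p
      = ∑ p : n.Partition, partitionWeight gapFreeWeight p :=
    Finset.sum_filter_of_ne fun p _ hp => by
      have h2 := two_le_nu_of_partitionWeight_ne_zero hp
      exact ⟨gapFree_of_two_le_nu h2, h2⟩
  rw [weightedCount, ← hfilter, Nat.cast_sum]
  refine Finset.sum_congr rfl fun p hp => ?_
  obtain ⟨-, -, h2⟩ := Finset.mem_filter.1 hp
  rw [partitionWeight]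
  split_ifs with h0
  · simp [Nat.Partition.largestMult, h0, nu_zero]
  · simp only [gapFreeWeight,
      prod_Icc_ite_eq (fun i => (p.nu i).choose 2) (fun i => p.nu i - 1) h0]
    rw [Nat.cast_mul, Nat.cast_choose_two, Nat.cast_prod, mul_comm]
    refine congrArg₂ _ rfl (Finset.prod_congr rfl fun i hi => ?_)
    have hi' := Finset.mem_Icc.1 hi
    rw [Nat.cast_pred (two_pos.trans_le (h2 i (Finset.mem_Icc.2 ⟨hi'.1, by lia⟩)))]

theorem hasSum_coeff_multSeries_divisors (n : ℕ) :
    HasSum (fun N => PowerSeries.coeff n (multSeries (N + 1) fun c => if c = 0 then 0 else 1))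
      n.divisors.card := by
  have hzero : ∀ N ∉ Finset.range n,
      PowerSeries.coeff n (multSeries (N + 1) fun c => if c = 0 then 0 else 1) = 0 := fun N hN => by
    have hlt : n < N + 1 := by simpa [Nat.lt_succ_iff] using hN
    simpa [multSeries, Nat.div_eq_zero_iff] using fun _ => Nat.lt_succ_iff.1 hlt
  have h := hasSum_sum_of_ne_finset_zero (L := .unconditional ℕ) hzero
  suffices n.divisors.card = ∑ N ∈ Finset.range n,
      PowerSeries.coeff n (multSeries (N + 1) fun c => if c = 0 then 0 else 1) by
    rw [this]
    exact h
  rw [Nat.divisors, Finset.card_filter, Finset.sum_Ico_eq_sum_range, Nat.add_sub_cancel]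
  refine Finset.sum_congr rfl fun N hN => ?_
  have hle : N + 1 ≤ n := Finset.mem_range.1 hN
  simp [multSeries, add_comm 1 N, Nat.div_eq_zero_iff, (Nat.lt_of_succ_le hle).not_ge]

/-! ### Evaluation of the generating functions -/

theorem hasSum_pred_mul_geometric {x : ℂ} (hx : ‖x‖ < 1) :
    HasSum (fun c : ℕ => ((c - 1 : ℕ) : ℂ) * x ^ c) (x ^ 2 / (1 - x) ^ 2) := by
  have h := (hasSum_coe_mul_geometric_of_norm_lt_one hx).mul_left x
  rw [← hasSum_nat_add_iff' 1]
  rw [show x * (x / (1 - x) ^ 2)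
    = x ^ 2 / (1 - x) ^ 2 - ∑ i ∈ Finset.range 1, ((i - 1 : ℕ) : ℂ) * x ^ i by simp; ring] at h
  refine HasSum.congr_fun h fun c => ?_
  rw [Nat.add_sub_cancel]
  ring

theorem hasSum_choose_two_mul_geometric {x : ℂ} (hx : ‖x‖ < 1) :
    HasSum (fun c : ℕ => (c.choose 2 : ℂ) * x ^ c) (x ^ 2 / (1 - x) ^ 3) := by
  have h := (hasSum_choose_mul_geometric_of_norm_lt_one 2 hx).mul_left (x ^ 2)
  rw [← hasSum_nat_add_iff' 2]
  rw [show x ^ 2 * (1 / (1 - x) ^ (2 + 1))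
    = x ^ 2 / (1 - x) ^ 3 - ∑ i ∈ Finset.range 2, ((i.choose 2 : ℕ) : ℂ) * x ^ i by
      simp [Finset.sum_range_succ]; ring] at h
  exact HasSum.congr_fun h fun c => by ring

theorem hasSum_pos_mul_geometric {x : ℂ} (hx : ‖x‖ < 1) :
    HasSum (fun c : ℕ => ((if c = 0 then 0 else 1 : ℕ) : ℂ) * x ^ c) (x / (1 - x)) := by
  have h := (hasSum_geometric_of_norm_lt_one hx).mul_left x
  rw [← hasSum_nat_add_iff' 1]
  rw [show x * (1 - x)⁻¹
    = x / (1 - x) - ∑ i ∈ Finset.range 1, ((if i = 0 then 0 else 1 : ℕ) : ℂ) * x ^ i by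
      simp [div_eq_mul_inv]] at h
  exact HasSum.congr_fun h fun c => by simp [pow_succ']

theorem qPoch_self_eq_prod_Icc (q : ℂ) (n : ℕ) :
    qPoch q q n = ∏ i ∈ Finset.Icc 1 n, (1 - q ^ i) := by
  induction n with
  | zero => simp [qPoch]
  | succ n ih => rw [qPoch_succ, ih, Finset.prod_Icc_succ_top (by lia), pow_succ']

theorem prod_Icc_pow_two (q : ℂ) (n : ℕ) :
    ∏ i ∈ Finset.Icc 1 n, (q ^ i) ^ 2 = q ^ (n * (n + 1)) := by
  induction n with
  | zero => simp
  | succ n ih =>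
    rw [Finset.prod_Icc_succ_top (by lia), ih]
    ring

section

variable {q : ℂ}

theorem norm_pow_lt_one (hq : ‖q‖ < 1) {i : ℕ} (hi : 1 ≤ i) : ‖q ^ i‖ < 1 := by
  rw [norm_pow]
  exact pow_lt_one₀ (norm_nonneg q) hq (by lia)

theorem evalsTo_divisorTerm (hq : ‖q‖ < 1) (N : ℕ) :
    EvalsTo (multSeries (N + 1) fun c => if c = 0 then 0 else 1) q (divisorTerm q 1 (N + 1)) := by
  have h := evalsTo_multSeries (i := N + 1) (by lia)
    (hasSum_pos_mul_geometric (norm_pow_lt_one hq (i := N + 1) (by lia)))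
  simpa [divisorTerm] using h

theorem evalsTo_lptTerm (hq : ‖q‖ < 1) (N : ℕ) :
    EvalsTo (∏ i ∈ Finset.Icc 1 (N + 1), multSeries i (lptWeight (N + 1) i)) q
      (lptTerm q 1 (N + 1)) := by
  have h : ∀ i ∈ Finset.Icc 1 (N + 1), EvalsTo (multSeries i (lptWeight (N + 1) i)) q
      (if i = N + 1 then q ^ i / (1 - q ^ i) ^ 2 else (1 - q ^ i)⁻¹) := fun i hi => by
    have hi' := (Finset.mem_Icc.1 hi).1
    refine evalsTo_multSeries hi' ?_
    split_ifs with heq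
    · simpa [lptWeight, heq] using
        hasSum_coe_mul_geometric_of_norm_lt_one (norm_pow_lt_one hq (i := N + 1) (by lia))
    · simpa [lptWeight, heq] using hasSum_geometric_of_norm_lt_one (norm_pow_lt_one hq hi')
  convert EvalsTo.prod h using 1
  rw [prod_Icc_ite_eq _ _ N.add_one_ne_zero, Nat.add_sub_cancel, Finset.prod_inv_distrib,
    ← qPoch_self_eq_prod_Icc, lptTerm, qPoch_succ, ← pow_succ']
  have h1 := qPoch_self_ne_zero hq N
  have h2 := one_sub_pow_succ_ne_zero hq N
  field_simp
  simp

theorem evalsTo_gapFreeTerm (hq : ‖q‖ < 1) (N : ℕ) :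
    EvalsTo (∏ i ∈ Finset.Icc 1 (N + 1), multSeries i (gapFreeWeight (N + 1) i)) q
      (gapFreeTerm q 1 (N + 1)) := by
  have h : ∀ i ∈ Finset.Icc 1 (N + 1), EvalsTo (multSeries i (gapFreeWeight (N + 1) i)) q
      (if i = N + 1 then (q ^ i) ^ 2 / (1 - q ^ i) ^ 3 else (q ^ i) ^ 2 / (1 - q ^ i) ^ 2) :=
    fun i hi => by
      have hi' := (Finset.mem_Icc.1 hi).1
      refine evalsTo_multSeries hi' ?_
      split_ifs with heq
      · simpa [gapFreeWeight, heq] using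
          hasSum_choose_two_mul_geometric (norm_pow_lt_one hq (i := N + 1) (by lia))
      · simpa only [gapFreeWeight, heq, if_false] using
          hasSum_pred_mul_geometric (norm_pow_lt_one hq hi')
  convert EvalsTo.prod h using 1
  rw [prod_Icc_ite_eq _ _ N.add_one_ne_zero, Nat.add_sub_cancel, Finset.prod_div_distrib,
    Finset.prod_pow _ 2 fun i => 1 - q ^ i, ← qPoch_self_eq_prod_Icc, prod_Icc_pow_two, gapFreeTerm,
    one_mul, qPoch_succ, ← pow_succ']
  have h1 := qPoch_self_ne_zero hq N
  have h2 := one_sub_pow_succ_ne_zero hq N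
  field_simp
  ring

end

/-! ### The partition identity -/

theorem card_divisors_add_weightedCount (n : ℕ) :
    (n.divisors.card : ℚ) + weightedCount n = lpt n := by
  have hone : ‖(1 : ℂ)‖ ≤ 1 := by simp
  have hlpt := fun q (hq : ‖q‖ < 1) => hasSum_of_evalsTo (fun q hq => evalsTo_lptTerm hq)
    (fun q hq => (isGeomBounded_lptTerm hq).summable hq hone)
    (hasSum_coeff_prod_multSeries (w := lptWeight) fun l => by simp [lptWeight]) hq
  have hgap := fun q (hq : ‖q‖ < 1) => hasSum_of_evalsTo (fun q hq => evalsTo_gapFreeTerm hq)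
    (fun q hq => (isGeomBounded_gapFreeTerm hq).summable hq hone)
    (hasSum_coeff_prod_multSeries (w := gapFreeWeight) fun l => by simp [gapFreeWeight]) hq
  have hdiv := fun q (hq : ‖q‖ < 1) => hasSum_of_evalsTo (fun q hq => evalsTo_divisorTerm hq)
    (fun q hq => (isGeomBounded_divisorTerm hq).summable hq hone)
    hasSum_coeff_multSeries_divisors hq
  have key := coeff_eq_of_hasSum
    (a := fun n => ((n.divisors.card + ∑ p : n.Partition, partitionWeight gapFreeWeight p : ℕ) : ℂ))
    (fun q hq => by
      have h := (hdiv q hq).add (hgap q hq)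
      rw [tsum_divisorTerm_add_tsum_gapFreeTerm hq hone] at h
      simpa [add_mul] using h) hlpt
  have hn := Nat.cast_injective (congrFun key n)
  rw [← sum_partitionWeight_gapFreeWeight, ← sum_partitionWeight_lptWeight, ← hn]
  push_cast
  rfl

theorem corollary2p10 :
    (∀ q : ℂ, ‖q‖ < 1 →
      (Summable fun n : ℕ+ => q ^ (n : ℕ) / (1 - q ^ (n : ℕ))) ∧
      (Summable fun n : ℕ+ =>
        q ^ ((n : ℕ) * ((n : ℕ) + 1)) / ((1 - q ^ (n : ℕ)) * qPoch q q n ^ 2)) ∧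
      (Summable fun n : ℕ+ => q ^ (n : ℕ) / ((1 - q ^ (n : ℕ)) * qPoch q q n)) ∧
      (∑' n : ℕ+, q ^ (n : ℕ) / (1 - q ^ (n : ℕ))) +
          (∑' n : ℕ+, q ^ ((n : ℕ) * ((n : ℕ) + 1)) / ((1 - q ^ (n : ℕ)) * qPoch q q n ^ 2)) =
        ∑' n : ℕ+, q ^ (n : ℕ) / ((1 - q ^ (n : ℕ)) * qPoch q q n)) ∧
    (∀ n : ℕ, 1 ≤ n → (n.divisors.card : ℚ) + weightedCount n = (lpt n : ℚ)) := by
  refine ⟨fun q hq => ?_, fun n _ => card_divisors_add_weightedCount n⟩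
  have hone : ‖(1 : ℂ)‖ ≤ 1 := by simp
  have hdiv : ∀ n : ℕ, q ^ n / (1 - q ^ n) = divisorTerm q 1 n := fun n => by simp [divisorTerm]
  have hgap : ∀ n : ℕ, q ^ (n * (n + 1)) / ((1 - q ^ n) * qPoch q q n ^ 2) = gapFreeTerm q 1 n :=
    fun n => by simp [gapFreeTerm, pow_two, mul_assoc]
  have hlpt : ∀ n : ℕ, q ^ n / ((1 - q ^ n) * qPoch q q n) = lptTerm q 1 n :=
    fun n => by simp [lptTerm]
  simp_rw [hdiv, hgap, hlpt]
  refine ⟨summable_pnat_iff_summable_succ.2 ((isGeomBounded_divisorTerm hq).summable hq hone),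
    summable_pnat_iff_summable_succ.2 ((isGeomBounded_gapFreeTerm hq).summable hq hone),
    summable_pnat_iff_summable_succ.2 ((isGeomBounded_lptTerm hq).summable hq hone), ?_⟩
  rw [tsum_pnat_eq_tsum_succ, tsum_pnat_eq_tsum_succ, tsum_pnat_eq_tsum_succ]
  exact tsum_divisorTerm_add_tsum_gapFreeTerm hq hone
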